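/- Permutations are finite, $|\pi|$ is the length of $\pi$, $S_k$ is the set of permutations of length $k$, and $\sigma\le\pi$ ("$\pi$ contains $\sigma$") means that some subsequence of $\pi$ is in the same relative order as $\sigma$. For $m\ge 4$ let $\sigma_m$ be the permutation in the same relative order as the first $m$ entries (if $m$ is even), respectively the $m$ least entries by value (if $m$ is odd), of the increasing oscillating sequence $4,1,6,3,8,5,\dots,2j+2,2j-1,\dots$. For a set $A$ of permutations and a permutation $\alpha$, let $U_{A,\alpha}$ be the set of all permutations obtained from some $\sigma_m$, $m\ge4$, by inflating its least entry and its greatest entry (if $m$ is even), respectively its least entry and its rightmost entry (if $m$ is odd), by $\alpha$, and inflating each of its other entries by an arbitrary element of $A$. (To inflate an entry by a permutation $\beta$ is to replace it by an interval order isomorphic to $\beta$.) Let $\alpha$ be a permutation of length $k+1$ and $\tau$ a permutation of length $k-1$ such that $\alpha$ does not contain $\tau$, and let $$A_\tau=\{\tau\}\cup\{\pi\in S_k : \tau\not\le\pi\}.$$ Let $U^{\le}_{A_\tau,\alpha}=\{\sigma : \sigma\le\pi \text{ for some } \pi\in U_{A_\tau,\alpha}\}$ be the downward closure of $U_{A_\tau,\alpha}$.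 Then the generating function $$\sum_{n\ge1}\bigl|\{\sigma\in U^{\le}_{A_\tau,\alpha} : |\sigma|=n\}\bigr|\,x^n$$ is rational, i.e. it is a quotient of two polynomials in $x$. -/

import Mathlib

/-- A permutation of unspecified finite length: a length `n` and a bijection of `Fin n`. -/
structure FinPerm where
  /-- the length `|π|` -/
  length : ℕ
  /-- the underlying bijection: entry number `i` (counted from `0`) has value `toPerm i` -/
  toPerm : Equiv.Perm (Fin length)

namespace FinPerm

/-- `σ.Contained π` is the containment order `σ ≤ π`: some subsequence of `π` is in the same
relative order as `σ`. -/
def Contained (σ π : FinPerm) : Prop :=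
  ∃ f : Fin σ.length ↪o Fin π.length,
    ∀ i j, σ.toPerm i < σ.toPerm j ↔ π.toPerm (f i) < π.toPerm (f j)

/-- The closure `{σ : σ ≤ π for some π ∈ X}` of a set of permutations. -/
def downClosure (X : Set FinPerm) : Set FinPerm :=
  {σ | ∃ π ∈ X, σ.Contained π}

/-- The increasing enumeration of a finite linear order `P`. -/
def position (P : Type) [LinearOrder P] [Fintype P] : Fin (Fintype.card P) ≃o P :=
  Fintype.orderIsoFinOfCardEq P rfl

/-- The enumeration of `P` by increasing values of the injective function `v`. -/
def rankBy {P V : Type} [Fintype P] [LinearOrder V] (v : P → V) (hv : Function.Injective v) :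
    Fin (Fintype.card P) ≃ P :=
  letI : LinearOrder P := LinearOrder.lift' v hv
  (position P).toEquiv

/-- `rankBy v hv` lists the elements of `P` by increasing value of `v`. -/
theorem rankBy_lt_iff {P V : Type} [Fintype P] [LinearOrder V] (v : P → V)
    (hv : Function.Injective v) (i j : Fin (Fintype.card P)) :
    v (rankBy v hv i) < v (rankBy v hv j) ↔ i < j :=
  letI : LinearOrder P := LinearOrder.lift' v hv
  (position P).lt_iff_lt

/-- The permutation in the same relative order as the sequence of distinct values `v p`, where the
index `p` runs through the finite linear order `P` in increasing order: it sends the position of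
`p` in `P` to the rank of `v p` among the values of `v`. -/
def pattern {P V : Type} [LinearOrder P] [Fintype P] [LinearOrder V]
    (v : P → V) (hv : Function.Injective v) : FinPerm where
  length := Fintype.card P
  toPerm := (position P).toEquiv.trans (rankBy v hv).symm

/-- The entries of `pattern v hv` compare as the entries of the sequence `v` do. -/
theorem pattern_lt_iff {P V : Type} [LinearOrder P] [Fintype P] [LinearOrder V]
    (v : P → V) (hv : Function.Injective v) (i j : Fin (Fintype.card P)) :
    (pattern v hv).toPerm i < (pattern v hv).toPerm j ↔
      v (position P i) < v (position P j) := by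
  have h := rankBy_lt_iff v hv ((rankBy v hv).symm (position P i))
    ((rankBy v hv).symm (position P j))
  simp only [Equiv.apply_symm_apply] at h
  exact h.symm

/-- The inflation `σ[β₀, β₁, …]`. Its entries are the pairs `(i, p)` with `p` an entry of `β i`,
in lexicographic order; the value of `(i, p)` is the pair `(σ i, β i p)`, and these are again
compared lexicographically. -/
def inflation (σ : FinPerm) (β : Fin σ.length → FinPerm) : FinPerm :=
  pattern
    (P := Σₗ i : Fin σ.length, Fin (β i).length)
    (V := Fin σ.length ×ₗ ℕ)
    (fun x => toLex (σ.toPerm (ofLex x).1, (((β (ofLex x).1).toPerm (ofLex x).2 : Fin _) : ℕ)))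
    (by
      intro x y h
      obtain ⟨i, p⟩ := x
      obtain ⟨j, q⟩ := y
      have h1 := Prod.mk.inj (toLex.injective h)
      obtain rfl : i = j := σ.toPerm.injective h1.1
      obtain rfl : p = q := (β i).toPerm.injective (Fin.ext h1.2)
      rfl)

/-- The increasing oscillating sequence `4, 1, 6, 3, 8, 5, …`, indexed from `0`. -/
def oscSeq (i : ℕ) : ℕ := if Even i then i + 4 else i

theorem oscSeq_injective : Function.Injective oscSeq := by
  intro i j h
  unfold oscSeq at h
  grind

/-- The indices of the entries of the increasing oscillating sequence which form `σ_m`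
(for `m ≥ 4`): the first `m` entries if `m` is even, the `m` least entries if `m` is odd.
The values of the sequence are `1, 3, 4, 5, …`, so that the `m` least ones are those up to
`m + 1`. -/
def oscIndices (m : ℕ) : Finset ℕ :=
  if Even m then Finset.range m else (Finset.range (m + 2)).filter (fun i => oscSeq i ≤ m + 1)

/-- For odd `m ≥ 3`, `oscIndices m` indexes `m` entries, and every other entry is larger. -/
theorem oscIndices_of_odd {m : ℕ} (hm : Odd m) (h3 : 3 ≤ m) :
    (oscIndices m).card = m ∧
      ∀ i ∈ oscIndices m, ∀ j, j ∉ oscIndices m → oscSeq i < oscSeq j := by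
  have he : ¬ Even m := Nat.not_even_iff_odd.mpr hm
  have hmem : ∀ i, i ∈ oscIndices m ↔ oscSeq i ≤ m + 1 := by
    intro i
    simp only [oscIndices, he, if_false, Finset.mem_filter, Finset.mem_range,
      and_iff_right_iff_imp]
    unfold oscSeq
    grind
  refine ⟨?_, fun i hi j hj => ?_⟩
  · have himg : (oscIndices m).image oscSeq = (Finset.Icc 1 (m + 1)).erase 2 := by
      ext v
      simp only [Finset.mem_image, hmem, Finset.mem_erase, Finset.mem_Icc]
      constructor
      · rintro ⟨i, hi, rfl⟩
        unfold oscSeq at *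
        grind
      · rintro ⟨h2, h1, hv⟩
        rcases Nat.even_or_odd v with hev | hod
        · have h4 : 4 ≤ v := by grind
          have : oscSeq (v - 4) = v := by
            unfold oscSeq
            grind
          exact ⟨v - 4, by omega, this⟩
        · have : oscSeq v = v := by
            unfold oscSeq
            grind
          exact ⟨v, by omega, this⟩
    rw [← Finset.card_image_of_injective _ oscSeq_injective, himg, Finset.card_erase_of_mem]
    · simp
    · simp only [Finset.mem_Icc]
      omega
  · rw [hmem] at hi hj
    omega

/-- The increasing oscillation `σ_m` (used for `m ≥ 4`). -/
def osc (m : ℕ) : FinPerm :=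
  pattern (P := {i // i ∈ oscIndices m}) (fun i => oscSeq i.1)
    (fun _ _ h => Subtype.ext (oscSeq_injective h))

/-- Entry `i` of `π` is its least entry (by value). -/
def IsLeastEntry (π : FinPerm) (i : Fin π.length) : Prop := ∀ j, π.toPerm i ≤ π.toPerm j

/-- Entry `i` of `π` is its greatest entry (by value). -/
def IsGreatestEntry (π : FinPerm) (i : Fin π.length) : Prop := ∀ j, π.toPerm j ≤ π.toPerm i

/-- Entry `i` of `π` is its rightmost entry. -/
def IsRightmostEntry (π : FinPerm) (i : Fin π.length) : Prop := ∀ j, j ≤ i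

/-- The entries of `σ_m` inflated by `α`: the least and the greatest entry if `m` is even, the
least and the rightmost entry if `m` is odd. -/
def IsOscEnd (m : ℕ) (i : Fin (osc m).length) : Prop :=
  (osc m).IsLeastEntry i ∨
    (Even m ∧ (osc m).IsGreatestEntry i) ∨ (Odd m ∧ (osc m).IsRightmostEntry i)

/-- The set `U_{A,α}`: all inflations of the `σ_m`, `m ≥ 4`, in which the two end entries are
inflated by `α` and all the other entries by arbitrary elements of `A`. -/
def oscAntichain (A : Set FinPerm) (α : FinPerm) : Set FinPerm :=
  {π | ∃ m : ℕ, 4 ≤ m ∧ ∃ β : Fin (osc m).length → FinPerm,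
    (∀ i, IsOscEnd m i → β i = α) ∧ (∀ i, ¬ IsOscEnd m i → β i ∈ A) ∧
      π = (osc m).inflation β}

/-- The set `A_τ = {τ} ∪ {π ∈ S_k : τ ≰ π}`, where `τ` has length `k - 1`. -/
def avoidSet (τ : FinPerm) : Set FinPerm :=
  {τ} ∪ {π | π.length = τ.length + 1 ∧ ¬ τ.Contained π}

/-- The generating function `∑_{n ≥ 1} |X_n| xⁿ` of a set of permutations; the empty permutation
is not counted. -/
noncomputable def genFun (X : Set FinPerm) : PowerSeries ℚ :=
  PowerSeries.mk fun n =>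
    if n = 0 then 0 else (({π : Equiv.Perm (Fin n) | (⟨n, π⟩ : FinPerm) ∈ X}.ncard : ℕ) : ℚ)

end FinPerm

/-- A formal power series over `ℚ` is rational if it is a quotient of two polynomials. -/
def IsRationalSeries (F : PowerSeries ℚ) : Prop :=
  ∃ p q : Polynomial ℚ, q ≠ 0 ∧ (q : PowerSeries ℚ) * F = (p : PowerSeries ℚ)

/-!
A permutation is determined by its Lehmer code, the word which records for each entry the number of
smaller entries to its right (`List.Perm.eq_of_lehmer_eq`). The generating function of a set of
permutations is therefore that of the language of its Lehmer codes, and it suffices that this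
language is regular over a finite alphabet: its words are then counted by a transfer matrix `M`, and
the adjugate of `1 - X M` gives a rational generating function (`isRationalSeries_of_isRegular`).

A subsequence of an inflated increasing oscillation is a sequence of blocks `c 0, c 1, c 2, …`, each
one a subsequence of the permutation by which the entry was inflated. In the oscillating sequence
`4, 1, 6, 3, 8, 5, …` the entry at an even index `i` has only the entries at the indices `i + 1` and
`i + 3` to its right and below it, and an entry at an odd index has none. The Lehmer code thus is
read off locally: the blocks at `2 j` and `2 j + 1` contribute a word which depends only on
`c (2 j)`, `c (2 j + 1)` and `c (2 j + 3)` (`lehmer_flatMap_oscBlock`). Since the blocks come from a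
finite set, the Lehmer codes of the closure are the words accepted by an automaton with finitely
many transitions labelled by words, whose states remember the next block at an odd index
(`exists_lehmer_downClosure_iff`). By the Myhill–Nerode theorem the language of such an automaton is
regular (`WordRun.isRegular`). Of the set `A_τ` only its finiteness matters.
-/

/-! ### Counting words of a regular language -/

/-- The words of length `n` over the finite alphabet `T`. -/
def wordsOver {A : Type} [DecidableEq A] (T : Finset A) : ℕ → Finset (List A)
  | 0 => {[]}
  | n + 1 => (T ×ˢ wordsOver T n).image fun x => x.1 :: x.2

theorem mem_wordsOver {A : Type} [DecidableEq A] (T : Finset A) (n : ℕ) (w : List A) :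
    w ∈ wordsOver T n ↔ w.length = n ∧ ∀ a ∈ w, a ∈ T := by
  induction n generalizing w with
  | zero =>
    simp only [wordsOver, Finset.mem_singleton, List.length_eq_zero_iff]
    constructor
    · rintro rfl
      simp
    · exact fun h => h.1
  | succ n ih =>
    simp only [wordsOver, Finset.mem_image, Finset.mem_product, Prod.exists, ih]
    cases w with
    | nil => simp
    | cons a w =>
      simp only [List.cons.injEq, List.length_cons, Nat.add_right_cancel_iff, List.mem_cons,
        forall_eq_or_imp]
      constructor
      · rintro ⟨b, v, h, rfl, rfl⟩
        tauto
      · intro h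
        exact ⟨a, w, by tauto, rfl, rfl⟩

theorem sum_wordsOver_succ {A : Type} [DecidableEq A] (T : Finset A) (n : ℕ)
    (f : List A → ℚ) :
    ∑ w ∈ wordsOver T (n + 1), f w = ∑ a ∈ T, ∑ w ∈ wordsOver T n, f (a :: w) := by
  rw [wordsOver, Finset.sum_image, Finset.sum_product]
  rintro ⟨a, v⟩ - ⟨b, w⟩ - h
  simpa using h

/-- A finite system of linear equations `F s = v s + X * ∑ t, M s t * F t` has rational solutions:
multiply by the adjugate of `1 - X M`. -/
theorem isRationalSeries_of_linear_system {S : Type} [Fintype S] [DecidableEq S]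
    (M : Matrix S S ℚ) (v : S → ℚ) (F : S → PowerSeries ℚ)
    (hF : ∀ s, F s = PowerSeries.C (v s) +
      PowerSeries.X * ∑ t, PowerSeries.C (M s t) * F t) (s : S) :
    IsRationalSeries (F s) := by
  let φ : Polynomial ℚ →+* PowerSeries ℚ := Polynomial.coeToPowerSeries.ringHom
  let P : Matrix S S (Polynomial ℚ) := 1 - (Polynomial.X : Polynomial ℚ) • M.map Polynomial.C
  have hP : P.det ≠ 0 := by
    intro h
    have h1 := M.eval_charpolyRev
    rw [show M.charpolyRev = P.det from rfl, h] at h1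
    simp at h1
  have hPF : (φ.mapMatrix P).mulVec F = fun t => PowerSeries.C (v t) := by
    funext t
    have hentry : ∀ u, φ.mapMatrix P t u =
        (if t = u then 1 else 0) - PowerSeries.X * PowerSeries.C (M t u) := by
      intro u
      have hu : P t u = (if t = u then 1 else 0) - Polynomial.X * Polynomial.C (M t u) := by
        simp [P, Matrix.one_apply]
      change φ (P t u) = _
      rw [hu]
      split_ifs <;> simp [φ] <;> exact mul_comm _ _
    have hrow : (φ.mapMatrix P).mulVec F t =
        F t - PowerSeries.X * ∑ u, PowerSeries.C (M t u) * F u := by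
      simp only [Matrix.mulVec, dotProduct, hentry, sub_mul, Finset.sum_sub_distrib,
        Finset.mul_sum, mul_assoc]
      simp
    rw [hrow, sub_eq_iff_eq_add]
    exact hF t
  refine ⟨∑ t, P.adjugate s t * Polynomial.C (v t), P.det, hP, ?_⟩
  have h2 := congrArg (fun G => (φ.mapMatrix P).adjugate.mulVec G s) hPF
  simp only [Matrix.mulVec_mulVec, Matrix.adjugate_mul, Matrix.smul_mulVec, Matrix.one_mulVec,
    Pi.smul_apply, smul_eq_mul] at h2
  rw [← RingHom.map_det, ← RingHom.map_adjugate] at h2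
  change φ P.det * F s = φ _
  refine (h2.trans (Finset.sum_congr rfl fun t _ => ?_)).trans (map_sum φ _ _).symm
  refine Eq.trans ?_ (map_mul φ _ _).symm
  simp [φ]

theorem IsRationalSeries.sub_C {F : PowerSeries ℚ} (hF : IsRationalSeries F) (c : ℚ) :
    IsRationalSeries (F - PowerSeries.C c) := by
  obtain ⟨p, q, hq, h⟩ := hF
  refine ⟨p - q * Polynomial.C c, q, hq, ?_⟩
  rw [mul_sub, h]
  simp

/-- The generating function of a regular language over a finite alphabet is rational. -/
theorem isRationalSeries_of_isRegular {A : Type} (L : Language A)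
    (hL : L.IsRegular) (T : Finset A) (hT : ∀ w ∈ L, ∀ a ∈ w, a ∈ T) :
    IsRationalSeries (PowerSeries.mk fun n => (({w ∈ L | w.length = n}.ncard : ℕ) : ℚ)) := by
  classical
  obtain ⟨S, _, D, rfl⟩ := hL
  let c : ℕ → S → ℚ := fun n s =>
    ∑ w ∈ wordsOver T n, if D.evalFrom s w ∈ D.accept then 1 else 0
  have hc : ∀ n s, c (n + 1) s =
      ∑ t, ((T.filter fun a => D.step s a = t).card : ℚ) * c n t := by
    intro n s
    have h1 : c (n + 1) s = ∑ a ∈ T, c n (D.step s a) :=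
      sum_wordsOver_succ T n _
    rw [h1, ← Finset.sum_fiberwise T (fun a => D.step s a)]
    refine Finset.sum_congr rfl fun t _ => ?_
    rw [Finset.sum_congr rfl (g := fun _ => c n t)
      (fun a ha => by rw [(Finset.mem_filter.mp ha).2])]
    simp
  have hcount : ∀ n, (({w ∈ D.accepts | w.length = n}.ncard : ℕ) : ℚ) = c n D.start := by
    intro n
    have hset : {w ∈ D.accepts | w.length = n} =
        ((wordsOver T n).filter fun w => D.evalFrom D.start w ∈ D.accept : Finset (List A)) := by
      ext w
      simp only [Set.mem_ofPred_eq, Finset.coe_filter, mem_wordsOver]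
      constructor
      · rintro ⟨hw, hn⟩
        exact ⟨⟨hn, hT w hw⟩, hw⟩
      · rintro ⟨⟨hn, -⟩, hw⟩
        exact ⟨hw, hn⟩
    rw [hset, Set.ncard_coe_finset]
    simp [c]
  simp_rw [hcount]
  refine isRationalSeries_of_linear_system
    (Matrix.of fun s t => ((T.filter fun a => D.step s a = t).card : ℚ))
    (fun s => c 0 s) (fun s => PowerSeries.mk fun n => c n s) (fun s => ?_) D.start
  ext n
  cases n with
  | zero => simp
  | succ n =>
    simp only [Matrix.of_apply, map_add, PowerSeries.coeff_succ_X_mul, map_sum,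
      PowerSeries.coeff_C_mul, PowerSeries.coeff_mk, PowerSeries.coeff_C, hc]
    simp

/-! ### Systems of transitions labelled by words -/

/-- `WordRun R accept s w`: some path of transitions of `R` leads from the state `s` to an
accepting state, and `w` is the concatenation of the words which label it. -/
inductive WordRun {S A : Type} (R : S → List A → S → Prop) (accept : S → Prop) :
    S → List A → Prop
  | nil {s} : accept s → WordRun R accept s []
  | cons {s u t w} : R s u t → WordRun R accept t w → WordRun R accept s (u ++ w)

/-- If finitely many pairs of a word and a target occur in the transitions, the words accepted from
a state form a regular language. After reading `x` one is inside or at the end of a label: what is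
still to be read is a suffix of that label and then a word accepted from its target, so that there
are finitely many left quotients. -/
theorem WordRun.isRegular {S A : Type} (R : S → List A → S → Prop) (accept : S → Prop)
    (hR : {x : List A × S | ∃ s, R s x.1 x.2}.Finite) (s : S) :
    Language.IsRegular ({w | WordRun R accept s w} : Language A) := by
  -- the pairs of a suffix of a label and the target of that label, and the empty word at the start
  let K : Set (List A × S) :=
    insert ([], s) (⋃ x ∈ {x : List A × S | ∃ s, R s x.1 x.2}, (fun v => (v, x.2)) '' {v | v <:+ x.1})
  have hK : K.Finite := by
    refine Set.Finite.insert _ (hR.biUnion fun x _ => Set.Finite.image _ ?_)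
    refine (List.finite_toSet x.1.tails).subset fun v hv => ?_
    simpa using hv
  let Lang : Set (List A × S) → Language A :=
    fun D => {y | ∃ x ∈ D, ∃ z, WordRun R accept x.2 z ∧ y = x.1 ++ z}
  -- runs from `t` through a whole number of transitions
  let Reach : S → List A → S → Prop :=
    fun t u t' => ∀ z, WordRun R accept t' z → WordRun R accept t (u ++ z)
  have split : ∀ t w, WordRun R accept t w → ∀ x y, w = x ++ y →
      ∃ v t', (v, t') ∈ insert (([] : List A), t) K ∧ Reach t (x ++ v) t' ∧
        ∃ z, WordRun R accept t' z ∧ y = v ++ z := by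
    intro t w h
    induction h with
    | @nil t ht =>
      intro x y hxy
      obtain ⟨rfl, rfl⟩ := List.append_eq_nil_iff.mp hxy.symm
      exact ⟨[], t, by simp, fun z hz => by simpa using hz, [], .nil ht, rfl⟩
    | @cons t u t₁ w h1 h2 ih =>
      intro x y hxy
      have hmem : ∀ v, v <:+ u → (v, t₁) ∈ K := fun v hv =>
        Set.mem_insert_of_mem _ (Set.mem_biUnion (x := (u, t₁)) ⟨t, h1⟩ ⟨v, hv, rfl⟩)
      rcases List.append_eq_append_iff.mp hxy with ⟨x', rfl, rfl⟩ | ⟨v, rfl, rfl⟩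
      · obtain ⟨v, t', hv, hr, z, hz, rfl⟩ := ih x' y rfl
        refine ⟨v, t', ?_, fun z hz => ?_, z, hz, rfl⟩
        · rcases hv with hv | hv
          · rw [hv]
            exact Set.mem_insert_of_mem _ (hmem [] List.nil_suffix)
          · exact Set.mem_insert_of_mem _ hv
        · simpa using WordRun.cons h1 (hr z hz)
      · exact ⟨v, t₁, Set.mem_insert_of_mem _ (hmem v (List.suffix_append _ _)),
          fun z hz => WordRun.cons h1 hz, w, h2, rfl⟩
  refine Language.IsRegular.of_finite_range_leftQuotient ((hK.finite_subsets.image Lang).subset ?_)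
  rintro _ ⟨x, rfl⟩
  refine ⟨{p ∈ K | Reach s (x ++ p.1) p.2}, fun p hp => hp.1, ?_⟩
  ext y
  constructor
  · rintro ⟨⟨v, t'⟩, ⟨-, hr⟩, z, hz, rfl⟩
    have := hr z hz
    rwa [List.append_assoc] at this
  · intro hy
    obtain ⟨v, t', hv, hr, z, hz, hyz⟩ := split s _ hy x y rfl
    refine ⟨(v, t'), ⟨?_, hr⟩, z, hz, hyz⟩
    rcases hv with hv | hv
    · exact hv ▸ Set.mem_insert _ _
    · exact hv

theorem WordRun.exists_label {S A : Type} {R : S → List A → S → Prop} {accept : S → Prop}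
    {s : S} {w : List A} (h : WordRun R accept s w) {a : A} (ha : a ∈ w) :
    ∃ t u t', R t u t' ∧ a ∈ u := by
  induction h with
  | nil => simp at ha
  | cons h1 _ ih =>
    rcases List.mem_append.mp ha with ha | ha
    · exact ⟨_, _, _, h1, ha⟩
    · exact ih ha

/-- The generating function, by length, of the words accepted from a state is rational. -/
theorem WordRun.isRationalSeries {S A : Type} (R : S → List A → S → Prop) (accept : S → Prop)
    (hR : {x : List A × S | ∃ s, R s x.1 x.2}.Finite) (s : S) :
    IsRationalSeries (PowerSeries.mk fun n =>
      (({w | WordRun R accept s w ∧ w.length = n}.ncard : ℕ) : ℚ)) := by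
  have hT : (⋃ x ∈ {x : List A × S | ∃ s, R s x.1 x.2}, {a | a ∈ x.1}).Finite :=
    hR.biUnion fun x _ => List.finite_toSet x.1
  refine isRationalSeries_of_isRegular _ (WordRun.isRegular R accept hR s) hT.toFinset ?_
  intro w hw a ha
  obtain ⟨t, u, t', h, hau⟩ := WordRun.exists_label hw ha
  rw [Set.Finite.mem_toFinset]
  exact Set.mem_biUnion (x := (u, t')) ⟨t, h⟩ hau

/-! ### Lehmer codes -/

/-- The Lehmer code of a sequence: each entry is replaced by the number of later smaller entries. -/
def lehmer {V : Type} [LinearOrder V] : List V → List ℕ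
  | [] => []
  | a :: l => l.countP (· < a) :: lehmer l

theorem length_lehmer {V : Type} [LinearOrder V] (l : List V) : (lehmer l).length = l.length := by
  induction l with
  | nil => rfl
  | cons a l ih => simp [lehmer, ih]

theorem lehmer_map_congr {ι V W : Type} [LinearOrder V] [LinearOrder W] (f : ι → V) (g : ι → W)
    (h : ∀ i j, f i < f j ↔ g i < g j) (s : List ι) : lehmer (s.map f) = lehmer (s.map g) := by
  induction s with
  | nil => rfl
  | cons a s ih =>
    simp only [List.map_cons, lehmer, ih, List.countP_map, List.cons.injEq, and_true]
    refine List.countP_congr fun x _ => ?_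
    simp [h]

theorem lehmer_append {V : Type} [LinearOrder V] (l₁ l₂ : List V) (c : ℕ)
    (h : ∀ a ∈ l₁, l₂.countP (· < a) = c) :
    lehmer (l₁ ++ l₂) = (lehmer l₁).map (· + c) ++ lehmer l₂ := by
  induction l₁ with
  | nil => rfl
  | cons a l ih =>
    simp only [List.mem_cons, forall_eq_or_imp] at h
    simp [lehmer, ih h.2, h.1]

/-- The Lehmer code determines the order of a given set of entries: the first entry is found from
the number of smaller ones, and so on. -/
theorem List.Perm.eq_of_lehmer_eq {V : Type} [LinearOrder V] {l₁ l₂ : List V} (hp : l₁.Perm l₂)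
    (h : lehmer l₁ = lehmer l₂) : l₁ = l₂ := by
  induction l₁ generalizing l₂ with
  | nil => exact (List.nil_perm.mp hp).symm
  | cons a l₁ ih =>
    cases l₂ with
    | nil => simp at hp
    | cons b l₂ =>
      simp only [lehmer, List.cons.injEq] at h
      have hlt : ∀ {x y : V} {l : List V}, x ∈ l → x < y →
          l.countP (· < x) < l.countP (· < y) := by
        intro x y l hx hxy
        induction l with
        | nil => simp at hx
        | cons z l ih' =>
          have hle : l.countP (· < x) ≤ l.countP (· < y) :=
            List.countP_mono_left fun w _ hw => by
              simp only [decide_eq_true_eq] at hw ⊢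
              exact hw.trans hxy
          simp only [List.countP_cons, decide_eq_true_eq]
          rcases List.mem_cons.mp hx with rfl | hx
          · simp only [lt_self_iff_false, if_false, hxy, if_true]
            omega
          · have := ih' hx
            have : z < x → z < y := fun hz => hz.trans hxy
            split_ifs <;> first | omega | (exfalso; tauto)
      have ha : (a :: l₁).countP (· < a) = l₁.countP (· < a) := by simp
      have hb : (a :: l₁).countP (· < b) = l₂.countP (· < b) := by
        rw [hp.countP_eq]
        simp
      have hab : a = b := by
        rcases lt_trichotomy a b with hab | hab | hab
        · have := hlt (l := a :: l₁) (by simp) hab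
          omega
        · exact hab
        · have := hlt (l := a :: l₁) (hp.mem_iff.mpr (by simp)) hab
          omega
      subst hab
      rw [ih (List.perm_cons _ |>.mp hp) h.2]

namespace FinPerm

/-- The entries of a permutation, as a list of natural numbers. -/
def entries (π : FinPerm) : List ℕ := (List.finRange π.length).map fun i => (π.toPerm i : ℕ)

theorem length_lehmer_entries (π : FinPerm) : (lehmer π.entries).length = π.length := by
  simp [length_lehmer, entries]

theorem lehmer_entries_injective (n : ℕ) :
    Function.Injective fun π : Equiv.Perm (Fin n) => lehmer (entries ⟨n, π⟩) := by
  intro π ρ h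
  have hperm : ∀ π : Equiv.Perm (Fin n), (entries ⟨n, π⟩).Perm ((List.finRange n).map Fin.val) := by
    intro π
    have := (List.map_perm_map_iff Fin.val_injective).mpr (Equiv.Perm.map_finRange_perm π)
    simpa [entries, Function.comp_def] using this
  have := ((hperm π).trans (hperm ρ).symm).eq_of_lehmer_eq h
  ext i
  simp only [entries, List.map_inj_left] at this
  exact this i (List.mem_finRange i)

/-- The sublists of the entries of a pattern have the same Lehmer codes as the subsequences of the
sequence of which it is the pattern. -/
theorem exists_sublist_entries_pattern {P V : Type} [LinearOrder P] [Fintype P] [LinearOrder V]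
    (v : P → V) (hv : Function.Injective v) (L : List P) (hL : L.Pairwise (· < ·))
    (hmem : ∀ p, p ∈ L) (w : List ℕ) :
    (∃ l, l.Sublist (pattern v hv).entries ∧ lehmer l = w) ↔
      ∃ l, l.Sublist (L.map v) ∧ lehmer l = w := by
  have hpos : L = (List.finRange (Fintype.card P)).map (position P) := by
    refine List.Pairwise.eq_of_mem_iff hL ?_ fun p => ?_
    · rw [List.pairwise_map]
      exact (List.pairwise_lt_finRange _).imp fun h => (position P).lt_iff_lt.mpr h
    · simp only [hmem, true_iff, List.mem_map, List.mem_finRange, true_and]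
      exact (position P).surjective p
  have hcode : ∀ s : List (Fin (Fintype.card P)),
      lehmer (s.map fun i => ((pattern v hv).toPerm i : ℕ)) =
        lehmer (s.map fun i => v (position P i)) :=
    lehmer_map_congr _ _ (pattern_lt_iff v hv)
  rw [hpos, List.map_map]
  constructor
  · rintro ⟨l, hl, rfl⟩
    obtain ⟨s, hs, rfl⟩ := List.sublist_map_iff.mp hl
    exact ⟨_, hs.map _, (hcode s).symm⟩
  · rintro ⟨l, hl, rfl⟩
    obtain ⟨s, hs, rfl⟩ := List.sublist_map_iff.mp hl
    exact ⟨_, hs.map _, hcode s⟩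

/-- The Lehmer codes of the permutations contained in `π` are those of the sublists of the
entries of `π`. -/
theorem exists_contained_lehmer_iff (π : FinPerm) (w : List ℕ) :
    (∃ σ : FinPerm, σ.Contained π ∧ lehmer σ.entries = w) ↔
      ∃ l, l.Sublist π.entries ∧ lehmer l = w := by
  constructor
  · rintro ⟨σ, ⟨f, hf⟩, rfl⟩
    refine ⟨((List.finRange σ.length).map f).map fun i => (π.toPerm i : ℕ), ?_, ?_⟩
    · refine List.Sublist.map _ (List.sublist_of_subperm_of_pairwise (r := (· < ·)) ?_ ?_ ?_)
      · refine List.subperm_of_subset ?_ fun i _ => List.mem_finRange i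
        exact (List.nodup_finRange _).map f.injective
      · rw [List.pairwise_map]
        exact (List.pairwise_lt_finRange _).imp fun h => f.lt_iff_lt.mpr h
      · exact List.pairwise_lt_finRange _
    · rw [List.map_map, entries]
      exact lehmer_map_congr (fun i => (π.toPerm (f i) : ℕ)) (fun i => (σ.toPerm i : ℕ))
        (fun i j => (hf i j).symm) _
  · rintro ⟨l, hl, rfl⟩
    obtain ⟨s, hs, rfl⟩ := List.sublist_map_iff.mp hl
    have hsp : s.Pairwise (· < ·) := (List.pairwise_lt_finRange _).sublist hs
    let v : {i // i ∈ s} → Fin π.length := fun i => π.toPerm i.1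
    have hv : Function.Injective v := fun i j h => Subtype.ext (π.toPerm.injective h)
    refine ⟨pattern v hv, ⟨OrderEmbedding.ofStrictMono
      (fun i => (position {i // i ∈ s} i).1) ?_, ?_⟩, ?_⟩
    · exact fun i j h => (position {i // i ∈ s}).lt_iff_lt.mpr h
    · exact fun i j => pattern_lt_iff v hv i j
    · have hpos : s = (List.finRange (Fintype.card {i // i ∈ s})).map
          fun i => (position {i // i ∈ s} i).1 := by
        refine List.Pairwise.eq_of_mem_iff hsp ?_ fun p => ?_
        · rw [List.pairwise_map]
          exact (List.pairwise_lt_finRange _).imp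
            fun h => (position {i // i ∈ s}).lt_iff_lt.mpr h
        · simp only [List.mem_map, List.mem_finRange, true_and]
          constructor
          · intro hp
            obtain ⟨i, hi⟩ := (position {i // i ∈ s}).surjective ⟨p, hp⟩
            exact ⟨i, by rw [hi]⟩
          · rintro ⟨i, rfl⟩
            exact (position {i // i ∈ s} i).2
      conv_rhs => rw [hpos]
      rw [List.map_map, entries]
      exact lehmer_map_congr (fun i => ((pattern v hv).toPerm i : ℕ))
        (fun i => (π.toPerm (position {i // i ∈ s} i).1 : ℕ)) (pattern_lt_iff v hv) _

/-- A set of permutations is counted by the Lehmer codes of its elements. -/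
theorem isRationalSeries_genFun (X : Set FinPerm)
    (h : IsRationalSeries (PowerSeries.mk fun n =>
      (({w | (∃ π ∈ X, lehmer π.entries = w) ∧ w.length = n}.ncard : ℕ) : ℚ))) :
    IsRationalSeries (genFun X) := by
  have hcount : ∀ n, {π : Equiv.Perm (Fin n) | (⟨n, π⟩ : FinPerm) ∈ X}.ncard =
      {w | (∃ π ∈ X, lehmer π.entries = w) ∧ w.length = n}.ncard := by
    intro n
    rw [← Set.ncard_image_of_injective _ (lehmer_entries_injective n)]
    congr 1
    ext w
    constructor
    · rintro ⟨π, hπ, rfl⟩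
      exact ⟨⟨_, hπ, rfl⟩, length_lehmer_entries _⟩
    · rintro ⟨⟨⟨m, π⟩, hπ, rfl⟩, hn⟩
      rw [length_lehmer_entries] at hn
      obtain rfl : m = n := hn
      exact ⟨π, hπ, rfl⟩
  convert h.sub_C
    (({π : Equiv.Perm (Fin 0) | (⟨0, π⟩ : FinPerm) ∈ X}.ncard : ℕ) : ℚ) using 1
  ext n
  cases n with
  -- the empty permutation is not counted by `genFun`
  | zero => simp [genFun, hcount]
  | succ n =>
    rw [map_sub, PowerSeries.coeff_C, genFun, PowerSeries.coeff_mk, PowerSeries.coeff_mk, hcount]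
    simp

/-! ### Lehmer codes of inflated oscillations -/

/-- The entry with index `i` of the increasing oscillating sequence, inflated by `c i`. -/
def oscBlock (c : ℕ → List ℕ) (i : ℕ) : List (ℕ ×ₗ ℕ) :=
  (c i).map fun y => toLex (oscSeq i, y)

/-- The Lehmer code of two consecutive blocks `e`, `d` of an inflated increasing oscillation, at an
even and an odd index; `d'` is the next block at an odd index. Every entry of `e` has all those
of `d` and `d'` to its right and below it, and none of the other later blocks is below. -/
def pairCode (e d d' : List ℕ) : List ℕ :=
  (lehmer e).map (· + (d.length + d'.length)) ++ lehmer d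

theorem lehmer_oscBlock (c : ℕ → List ℕ) (i : ℕ) : lehmer (oscBlock c i) = lehmer (c i) := by
  rw [oscBlock, lehmer_map_congr _ id (fun x y => ?_), List.map_id]
  simp [Prod.Lex.toLex_lt_toLex]

theorem countP_oscBlock (c : ℕ → List ℕ) {i j : ℕ} (h : i ≠ j) (y : ℕ) :
    (oscBlock c i).countP (· < toLex (oscSeq j, y)) =
      if oscSeq i < oscSeq j then (c i).length else 0 := by
  have hij : oscSeq i ≠ oscSeq j := fun h' => h (oscSeq_injective h')
  split_ifs with hlt <;> simp [oscBlock, List.countP_map, Function.comp_def,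
    Prod.Lex.toLex_lt_toLex, hlt, hij]

theorem lehmer_flatMap_congr {I V W : Type} [LinearOrder V] [LinearOrder W] (f : I → V)
    (g : I → W) (h : ∀ i j, f i < f j ↔ g i < g j) (h' : ∀ i j, f i = f j ↔ g i = g j)
    (c : I → List ℕ) (s : List I) :
    lehmer (s.flatMap fun i => (c i).map fun y => toLex (f i, y)) =
      lehmer (s.flatMap fun i => (c i).map fun y => toLex (g i, y)) := by
  have key := lehmer_map_congr (fun x : I × ℕ => toLex (f x.1, x.2))
    (fun x : I × ℕ => toLex (g x.1, x.2))
    (fun x y => by simp [Prod.Lex.toLex_lt_toLex, h, h'])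
    (s.flatMap fun i => (c i).map fun y => (i, y))
  simpa [List.map_flatMap, Function.comp_def] using key

theorem flatMap_range_add_two {W : Type} (f : ℕ → List W) (n : ℕ) :
    (List.range (n + 2)).flatMap f =
      f 0 ++ (f 1 ++ (List.range n).flatMap fun i => f (i + 2)) := by
  rw [List.range_succ_eq_map, List.range_succ_eq_map]
  simp [List.flatMap_map]

/-- The Lehmer code of an inflated oscillation is read off locally, two blocks at a time. -/
theorem lehmer_flatMap_oscBlock (c : ℕ → List ℕ) (R : ℕ) (hc : ∀ i, 2 * R ≤ i → c i = []) :
    lehmer ((List.range (2 * R)).flatMap (oscBlock c)) =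
      (List.range R).flatMap fun j => pairCode (c (2 * j)) (c (2 * j + 1)) (c (2 * j + 3)) := by
  induction R generalizing c with
  | zero => rfl
  | succ R ih =>
    have hshift : lehmer ((List.range (2 * R)).flatMap fun i => oscBlock c (i + 2)) =
        lehmer ((List.range (2 * R)).flatMap (oscBlock fun i => c (i + 2))) := by
      have hs : ∀ i, oscSeq (i + 2) = oscSeq i + 2 := by
        intro i
        unfold oscSeq
        grind
      exact lehmer_flatMap_congr (fun i => oscSeq (i + 2)) oscSeq (fun i j => by simp [hs])
        (fun i j => by simp [hs]) (fun i => c (i + 2)) _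
    have h1 : ∀ a ∈ oscBlock c 1,
        ((List.range (2 * R)).flatMap fun i => oscBlock c (i + 2)).countP (· < a) = 0 := by
      intro a ha
      obtain ⟨y, -, rfl⟩ := List.mem_map.mp ha
      rw [List.countP_flatMap]
      refine List.sum_eq_zero fun n hn => ?_
      obtain ⟨i, -, rfl⟩ := List.mem_map.mp hn
      have : ¬ oscSeq (i + 2) < oscSeq 1 := by
        unfold oscSeq
        grind
      simp only [Function.comp_apply]
      rw [countP_oscBlock c (by omega), if_neg this]
    have h0 : ∀ a ∈ oscBlock c 0,
        (oscBlock c 1 ++ (List.range (2 * R)).flatMap fun i => oscBlock c (i + 2)).countP (· < a) =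
          (c 1).length + (c 3).length := by
      intro a ha
      obtain ⟨y, -, rfl⟩ := List.mem_map.mp ha
      rw [List.countP_append, countP_oscBlock c (by omega), if_pos (by decide)]
      congr 1
      cases R with
      | zero => simp [hc 3 (by omega)]
      | succ R =>
        rw [Nat.mul_succ, flatMap_range_add_two, List.countP_append, List.countP_append,
          countP_oscBlock c (by omega), countP_oscBlock c (by omega), if_neg (by decide),
          if_pos (by decide), List.countP_flatMap, List.sum_eq_zero]
        · simp
        · intro n hn
          obtain ⟨i, -, rfl⟩ := List.mem_map.mp hn
          have : ¬ oscSeq (i + 2 + 2) < oscSeq 0 := by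
            unfold oscSeq
            grind
          simp only [Function.comp_apply]
          rw [countP_oscBlock c (by omega), if_neg this]
    rw [Nat.mul_succ, flatMap_range_add_two, lehmer_append _ _ _ h0, lehmer_append _ _ _ h1,
      hshift, ih _ (fun i hi => hc _ (by omega)), lehmer_oscBlock, lehmer_oscBlock,
      List.range_succ_eq_map]
    simp [pairCode, List.flatMap_map, Nat.mul_add, add_right_comm]

theorem mem_oscIndices (m i : ℕ) :
    i ∈ oscIndices m ↔ (Even m ∧ i < m) ∨ (Odd m ∧ i ≤ m ∧ i + 1 ≠ m) := by
  unfold oscIndices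
  split_ifs with h
  · simp [h]
  · simp only [oscSeq]
    grind

/-- The index of the greatest entry of `osc m` if `m` is even, and of its rightmost entry if `m` is
odd. -/
def upperEnd (m : ℕ) : ℕ := if Even m then m - 2 else m

/-- `c` lists the blocks of a subsequence of an inflation of `osc m`, with no entries outside
`osc m`: the block at the upper end is in `B`, that of the least entry (at index `1`) in `E`, and
the other ones are in `A`. -/
structure IsOscFilling (A B E : Set (List ℕ)) (m : ℕ) (c : ℕ → List ℕ) : Prop where
  lower : c 1 ∈ E
  upper : c (upperEnd m) ∈ B
  inner : ∀ i ∈ oscIndices m, i ≠ 1 → i ≠ upperEnd m → c i ∈ A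
  outer : ∀ i, i ∉ oscIndices m → c i = []

/-- The Lehmer code of the subsequence of an inflation of `osc m` with blocks `c`. -/
def oscCode (m : ℕ) (c : ℕ → List ℕ) : List ℕ :=
  (List.range ((m + 1) / 2)).flatMap fun j => pairCode (c (2 * j)) (c (2 * j + 1)) (c (2 * j + 3))

theorem oscCode_add_two (m : ℕ) (c : ℕ → List ℕ) :
    oscCode (m + 2) c = pairCode (c 0) (c 1) (c 3) ++ oscCode m fun i => c (i + 2) := by
  rw [oscCode, oscCode, show (m + 2 + 1) / 2 = (m + 1) / 2 + 1 by omega, List.range_succ_eq_map]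
  simp [List.flatMap_map, Nat.mul_add, add_right_comm]

/-- Removing the first two blocks of a filling leaves a filling whose block at index `1` is no
longer an end. -/
theorem isOscFilling_add_two {A B E : Set (List ℕ)} {m : ℕ} (hm : 2 ≤ m) {c : ℕ → List ℕ} :
    IsOscFilling A B E (m + 2) c ↔
      c 0 ∈ A ∧ c 1 ∈ E ∧ IsOscFilling A B A m fun i => c (i + 2) := by
  have hu : upperEnd (m + 2) = upperEnd m + 2 := by
    unfold upperEnd
    grind
  have hmem : ∀ i, i + 2 ∈ oscIndices (m + 2) ↔ i ∈ oscIndices m := by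
    intro i
    rw [mem_oscIndices, mem_oscIndices]
    grind
  have h0 : 0 ∈ oscIndices (m + 2) := by
    rw [mem_oscIndices]
    grind
  have h1 : 1 ∈ oscIndices (m + 2) := by
    rw [mem_oscIndices]
    grind
  have h1' : 1 ∈ oscIndices m := by
    rw [mem_oscIndices]
    grind
  have hu1 : upperEnd m ≠ 1 := by
    unfold upperEnd
    grind
  constructor
  · intro h
    refine ⟨h.inner 0 h0 (by omega) (by omega), h.lower,
      h.inner 3 ((hmem 1).mpr h1') (by omega) (by omega), hu ▸ h.upper, ?_, ?_⟩
    · exact fun i hi _ hiu => h.inner _ ((hmem i).mpr hi) (by omega) (by omega)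
    · exact fun i hi => h.outer _ (fun h' => hi ((hmem i).mp h'))
  · rintro ⟨hc0, hc1, h⟩
    refine ⟨hc1, hu ▸ h.upper, ?_, ?_⟩
    · rintro (_ | _ | i) hi h2 h3
      · exact hc0
      · omega
      · by_cases hi1 : i = 1
        · subst hi1
          exact h.lower
        · exact h.inner i ((hmem i).mp hi) hi1 (by omega)
    · rintro (_ | _ | i) hi
      · exact absurd h0 hi
      · exact absurd h1 hi
      · exact h.outer i (fun h' => hi ((hmem i).mpr h'))

theorem isOscFilling_two {A B E : Set (List ℕ)} {c : ℕ → List ℕ} :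
    IsOscFilling A B E 2 c ↔ c 0 ∈ B ∧ c 1 ∈ E ∧ ∀ i, c (i + 2) = [] := by
  have hmem : ∀ i, i ∈ oscIndices 2 ↔ i < 2 := by
    intro i
    simp [mem_oscIndices]
  have hu : upperEnd 2 = 0 := rfl
  constructor
  · intro h
    exact ⟨h.upper, h.lower, fun i => h.outer _ (by simp [hmem])⟩
  · rintro ⟨h0, h1, h2⟩
    refine ⟨h1, h0, fun i hi _ _ => ?_, fun i hi => ?_⟩
    · rw [hmem] at hi
      omega
    · rw [hmem, not_lt] at hi
      obtain ⟨j, rfl⟩ := Nat.exists_eq_add_of_le' hi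
      exact h2 j

theorem isOscFilling_three {A B E : Set (List ℕ)} {c : ℕ → List ℕ} :
    IsOscFilling A B E 3 c ↔
      c 0 ∈ A ∧ c 1 ∈ E ∧ c 2 = [] ∧ c 3 ∈ B ∧ ∀ i, c (i + 4) = [] := by
  have hmem : ∀ i, i ∈ oscIndices 3 ↔ i ≤ 3 ∧ i ≠ 2 := by
    intro i
    rw [mem_oscIndices]
    grind
  have hu : upperEnd 3 = 3 := rfl
  constructor
  · intro h
    exact ⟨h.inner 0 (by simp [hmem]) (by omega) (by omega), h.lower,
      h.outer _ (by simp [hmem]), h.upper, fun i => h.outer _ (by simp [hmem])⟩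
  · rintro ⟨h0, h1, h2, h3, h4⟩
    refine ⟨h1, h3, fun i hi _ _ => ?_, fun i hi => ?_⟩
    · rw [hmem] at hi
      obtain rfl : i = 0 := by omega
      exact h0
    · rw [hmem] at hi
      by_cases h : i = 2
      · exact h ▸ h2
      · obtain ⟨j, rfl⟩ := Nat.exists_eq_add_of_le' (show 4 ≤ i by omega)
        exact h4 j

/-! ### The automaton which reads inflated oscillations -/

/-- The states of the automaton: before the first pair of blocks, before a pair of blocks of which
the second one is `d`, and after the last pair. -/
inductive OscState
  | start
  | inner (d : List ℕ)
  | done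

/-- The transitions of the automaton. Each but the last reads the code of one pair of blocks; the
last one reads the code of the rest, which depends on the parity of the length. -/
inductive OscStep (A B : Set (List ℕ)) : OscState → List ℕ → OscState → Prop
  | first {e d d'} : e ∈ A → d ∈ B → d' ∈ A → OscStep A B .start (pairCode e d d') (.inner d')
  | middle {e d d'} : e ∈ A → d ∈ A → d' ∈ A →
      OscStep A B (.inner d) (pairCode e d d') (.inner d')
  | lastEven {e d} : e ∈ B → d ∈ A → OscStep A B (.inner d) (pairCode e d []) .done
  | lastOdd {e d d'} : e ∈ A → d ∈ A → d' ∈ B →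
      OscStep A B (.inner d) (pairCode e d d' ++ pairCode [] d' []) .done

theorem finite_oscStep {A B : Set (List ℕ)} (hA : A.Finite) (hB : B.Finite) :
    {x : List ℕ × OscState | ∃ s, OscStep A B s x.1 x.2}.Finite := by
  let C : Set (List ℕ) := insert [] (A ∪ B)
  have hC : C.Finite := (hA.union hB).insert _
  let g : List ℕ × List ℕ × List ℕ → List ℕ := fun x => pairCode x.1 x.2.1 x.2.2
  let g' : List ℕ × List ℕ × List ℕ → List ℕ :=
    fun x => pairCode x.1 x.2.1 x.2.2 ++ pairCode [] x.2.2 []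
  have hCCC : (C ×ˢ C ×ˢ C).Finite := hC.prod (hC.prod hC)
  refine (((hCCC.image g).union (hCCC.image g')).prod
    ((hA.image OscState.inner).insert .done)).subset ?_
  have hnil : [] ∈ C := Set.mem_insert _ _
  have hAC : ∀ {x}, x ∈ A → x ∈ C := fun h => Set.mem_insert_of_mem _ (.inl h)
  have hBC : ∀ {x}, x ∈ B → x ∈ C := fun h => Set.mem_insert_of_mem _ (.inr h)
  rintro ⟨w, t⟩ ⟨s, h⟩
  simp only at h
  cases h with
  | @first e d d' he hd hd' =>
    exact ⟨.inl ⟨(e, d, d'), ⟨hAC he, hBC hd, hAC hd'⟩, rfl⟩, .inr ⟨d', hd', rfl⟩⟩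
  | @middle e d d' he hd hd' =>
    exact ⟨.inl ⟨(e, d, d'), ⟨hAC he, hAC hd, hAC hd'⟩, rfl⟩, .inr ⟨d', hd', rfl⟩⟩
  | @lastEven e d he hd =>
    exact ⟨.inl ⟨(e, d, []), ⟨hBC he, hAC hd, hnil⟩, rfl⟩, .inl rfl⟩
  | @lastOdd e d d' he hd hd' =>
    exact ⟨.inr ⟨(e, d, d'), ⟨hAC he, hAC hd, hBC hd'⟩, rfl⟩, .inl rfl⟩

/-- The sequence which starts with `e`, `d` and continues with `c`. -/
def consTwo (e d : List ℕ) (c : ℕ → List ℕ) : ℕ → List ℕ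
  | 0 => e
  | 1 => d
  | i + 2 => c i

theorem wordRun_done {A B : Set (List ℕ)} {w : List ℕ}
    (h : WordRun (OscStep A B) (· = .done) .done w) : w = [] := by
  cases h with
  | nil => rfl
  | cons h _ => cases h

/-- The words accepted from `inner d` are the codes of fillings which begin with any block at index
`0` and `d` at index `1`; the least entry is then an end no longer, whence `A` in its place. -/
theorem wordRun_inner_iff {A B : Set (List ℕ)} {d w : List ℕ} :
    WordRun (OscStep A B) (· = .done) (.inner d) w ↔
      ∃ m c, 2 ≤ m ∧ c 1 = d ∧ IsOscFilling A B A m c ∧ w = oscCode m c := by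
  constructor
  · generalize hs : OscState.inner d = s
    intro h
    induction h generalizing d with
    | nil h => simp [← hs] at h
    | @cons s u t w h h' ih =>
      subst hs
      cases h with
      | @middle e _ d' he hd hd' =>
        obtain ⟨m, c, hm, hc1, hc, rfl⟩ := ih rfl
        refine ⟨m + 2, consTwo e d c, by omega, rfl,
          (isOscFilling_add_two hm).mpr ⟨he, hd, hc⟩, ?_⟩
        rw [oscCode_add_two, ← hc1]
        rfl
      | @lastEven e _ he hd =>
        obtain rfl := wordRun_done h'
        refine ⟨2, consTwo e d fun _ => [], le_rfl, rfl,
          isOscFilling_two.mpr ⟨he, hd, fun _ => rfl⟩, ?_⟩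
        simp [oscCode, consTwo]
      | @lastOdd e _ d' he hd hd' =>
        obtain rfl := wordRun_done h'
        refine ⟨3, consTwo e d (consTwo [] d' fun _ => []), by omega, rfl,
          isOscFilling_three.mpr ⟨he, hd, rfl, hd', fun _ => rfl⟩, ?_⟩
        simp [oscCode, consTwo, List.range_succ]
  · rintro ⟨m, c, hm, rfl, hc, rfl⟩
    induction m using Nat.strong_induction_on generalizing c with
    | _ m ih =>
      obtain rfl | rfl | ⟨m, hm', rfl⟩ : m = 2 ∨ m = 3 ∨ ∃ m', 2 ≤ m' ∧ m = m' + 2 := by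
        rcases Nat.lt_or_ge m 4 with h | h
        · omega
        · exact .inr (.inr ⟨m - 2, by omega, by omega⟩)
      · obtain ⟨h0, h1, h2⟩ := isOscFilling_two.mp hc
        have := WordRun.cons (OscStep.lastEven h0 h1)
          (WordRun.nil (accept := (· = OscState.done)) rfl)
        simpa [oscCode, h2 1] using this
      · obtain ⟨h0, h1, h2, h3, h4⟩ := isOscFilling_three.mp hc
        have := WordRun.cons (OscStep.lastOdd h0 h1 h3)
          (WordRun.nil (accept := (· = OscState.done)) rfl)
        simpa [oscCode, List.range_succ, h2, h4 1] using this
      · obtain ⟨h0, h1, h⟩ := (isOscFilling_add_two hm').mp hc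
        rw [oscCode_add_two]
        exact .cons (.middle h0 h1 h.lower) (ih m (by omega) _ hm' h)

theorem wordRun_start_iff {A B : Set (List ℕ)} {w : List ℕ} :
    WordRun (OscStep A B) (· = .done) .start w ↔
      ∃ m c, 4 ≤ m ∧ IsOscFilling A B B m c ∧ w = oscCode m c := by
  constructor
  · intro h
    cases h with
    | nil h => simp at h
    | cons h h' =>
      cases h with
      | @first e d d' he hd hd' =>
        obtain ⟨m, c, hm, hc1, hc, rfl⟩ := wordRun_inner_iff.mp h'
        refine ⟨m + 2, consTwo e d c, by omega,
          (isOscFilling_add_two hm).mpr ⟨he, hd, hc⟩, ?_⟩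
        rw [oscCode_add_two, ← hc1]
        rfl
  · rintro ⟨m, c, hm, hc, rfl⟩
    obtain ⟨m, rfl⟩ := Nat.exists_eq_add_of_le' (show 2 ≤ m by omega)
    obtain ⟨h0, h1, h⟩ := (isOscFilling_add_two (by omega)).mp hc
    rw [oscCode_add_two]
    exact .cons (.first h0 h1 h.lower)
      (wordRun_inner_iff.mpr ⟨m, _, by omega, rfl, h, rfl⟩)

/-! ### Subsequences of inflations -/

theorem sublist_flatMap_iff {I W : Type} (s : List I) (hs : s.Nodup) (f : I → List W)
    (l : List W) :
    l.Sublist (s.flatMap f) ↔ ∃ g : I → List W, (∀ i, (g i).Sublist (f i)) ∧ l = s.flatMap g := by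
  classical
  constructor
  · intro h
    induction s generalizing l with
    | nil =>
      obtain rfl : l = [] := by simpa using h
      exact ⟨fun _ => [], fun _ => List.nil_sublist _, rfl⟩
    | cons a s ih =>
      rw [List.flatMap_cons, List.sublist_append_iff] at h
      obtain ⟨l₁, l₂, rfl, h1, h2⟩ := h
      obtain ⟨ha, hs⟩ := List.nodup_cons.mp hs
      obtain ⟨g, hg, rfl⟩ := ih hs l₂ h2
      refine ⟨Function.update g a l₁, fun i => ?_, ?_⟩
      · by_cases hi : i = a
        · subst hi
          simpa using h1
        · simpa [hi] using hg i
      · rw [List.flatMap_cons, Function.update_self]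
        congr 1
        refine List.flatMap_congr fun i hi => ?_
        rw [Function.update_of_ne]
        rintro rfl
        exact ha hi
  · rintro ⟨g, hg, rfl⟩
    induction s with
    | nil => exact List.Sublist.refl _
    | cons a s ih =>
      exact (hg a).append (ih (List.nodup_cons.mp hs).2)

theorem exists_sublist_entries_inflation (σ : FinPerm) (β : Fin σ.length → FinPerm)
    (w : List ℕ) :
    (∃ l, l.Sublist (σ.inflation β).entries ∧ lehmer l = w) ↔
      ∃ c : Fin σ.length → List ℕ, (∀ i, (c i).Sublist (β i).entries) ∧
        lehmer ((List.finRange σ.length).flatMap fun i =>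
          (c i).map fun y => toLex (σ.toPerm i, y)) = w := by
  let L : List (Σₗ i : Fin σ.length, Fin (β i).length) :=
    (List.finRange σ.length).flatMap fun i =>
      (List.finRange (β i).length).map fun p => toLex ⟨i, p⟩
  have hv : L.map (fun x => (toLex (σ.toPerm (ofLex x).1,
        (((β (ofLex x).1).toPerm (ofLex x).2 : Fin _) : ℕ)) : Fin σ.length ×ₗ ℕ)) =
      (List.finRange σ.length).flatMap fun i =>
        (β i).entries.map fun y => toLex (σ.toPerm i, y) := by
    simp only [L, List.map_flatMap, List.map_map, entries]
    rfl
  refine (exists_sublist_entries_pattern _ _ L ?_ ?_ w).trans ?_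
  · rw [List.pairwise_flatMap]
    constructor
    · intro i _
      rw [List.pairwise_map]
      refine (List.pairwise_lt_finRange _).imp fun h => ?_
      exact Sigma.Lex.right _ _ h
    · refine (List.pairwise_lt_finRange _).imp fun h => ?_
      intro x hx y hy
      obtain ⟨p, -, rfl⟩ := List.mem_map.mp hx
      obtain ⟨q, -, rfl⟩ := List.mem_map.mp hy
      exact Sigma.Lex.left _ _ h
  · rintro ⟨i, p⟩
    exact List.mem_flatMap.mpr ⟨i, List.mem_finRange i,
      List.mem_map.mpr ⟨p, List.mem_finRange p, rfl⟩⟩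
  rw [hv]
  constructor
  · rintro ⟨l, hl, rfl⟩
    obtain ⟨g, hg, rfl⟩ := (sublist_flatMap_iff _ (List.nodup_finRange _) _ _).mp hl
    choose c hc hgc using fun i => List.sublist_map_iff.mp (hg i)
    refine ⟨c, hc, ?_⟩
    simp only [← hgc]
  · rintro ⟨c, hc, rfl⟩
    exact ⟨_, (sublist_flatMap_iff _ (List.nodup_finRange _) _ _).mpr
      ⟨_, fun i => (hc i).map _, rfl⟩, rfl⟩

/-- The index in the increasing oscillating sequence of entry `i` of `osc m`. -/
def oscIndex (m : ℕ) (i : Fin (osc m).length) : ℕ := (position {i // i ∈ oscIndices m} i).1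

theorem oscIndex_strictMono (m : ℕ) : StrictMono (oscIndex m) :=
  fun _ _ h => (position {i // i ∈ oscIndices m}).lt_iff_lt.mpr h

theorem oscIndex_mem (m : ℕ) (i : Fin (osc m).length) : oscIndex m i ∈ oscIndices m :=
  (position {i // i ∈ oscIndices m} i).2

theorem exists_oscIndex_eq {m n : ℕ} (hn : n ∈ oscIndices m) : ∃ i, oscIndex m i = n := by
  obtain ⟨i, hi⟩ := (position {i // i ∈ oscIndices m}).surjective ⟨n, hn⟩
  exact ⟨i, congrArg Subtype.val hi⟩

theorem osc_lt_iff (m : ℕ) (i j : Fin (osc m).length) :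
    (osc m).toPerm i < (osc m).toPerm j ↔ oscSeq (oscIndex m i) < oscSeq (oscIndex m j) :=
  pattern_lt_iff _ _ i j

theorem osc_le_iff (m : ℕ) (i j : Fin (osc m).length) :
    (osc m).toPerm i ≤ (osc m).toPerm j ↔ oscSeq (oscIndex m i) ≤ oscSeq (oscIndex m j) := by
  rw [← not_lt, ← not_lt, osc_lt_iff]

theorem isOscEnd_iff {m : ℕ} (hm : 4 ≤ m) (i : Fin (osc m).length) :
    IsOscEnd m i ↔ oscIndex m i = 1 ∨ oscIndex m i = upperEnd m := by
  -- an extremal entry is found by comparing it with the one at the expected index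
  have ext : ∀ (r : ℕ → ℕ → Prop), (∀ a b, r a b → r b a → a = b) →
      ∀ n ∈ oscIndices m, (∀ a ∈ oscIndices m, r n a) →
        ((∀ j, r (oscIndex m i) (oscIndex m j)) ↔ oscIndex m i = n) := by
    intro r hr n hn hmin
    constructor
    · intro h
      obtain ⟨j, rfl⟩ := exists_oscIndex_eq hn
      exact hr _ _ (h j) (hmin _ (oscIndex_mem m i))
    · intro h j
      rw [h]
      exact hmin _ (oscIndex_mem m j)
  have hleast : (osc m).IsLeastEntry i ↔ oscIndex m i = 1 := by
    simp only [IsLeastEntry, osc_le_iff]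
    refine ext (fun a b => oscSeq a ≤ oscSeq b)
      (fun a b h h' => oscSeq_injective (le_antisymm h h')) 1 ?_ fun a _ => ?_
    · rw [mem_oscIndices]
      grind
    · simp only [oscSeq]
      grind
  rw [IsOscEnd, hleast]
  refine or_congr_right ?_
  rcases Nat.even_or_odd m with he | ho
  · have ho : ¬ Odd m := Nat.not_odd_iff_even.mpr he
    simp only [he, ho, true_and, false_and, or_false, upperEnd, if_true]
    simp only [IsGreatestEntry, osc_le_iff]
    refine ext (fun a b => oscSeq b ≤ oscSeq a)
      (fun a b h h' => oscSeq_injective (le_antisymm h' h)) (m - 2) ?_ fun a ha => ?_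
    · rw [mem_oscIndices]
      grind
    · rw [mem_oscIndices] at ha
      simp only [oscSeq]
      grind
  · have he : ¬ Even m := Nat.not_even_iff_odd.mpr ho
    simp only [he, ho, true_and, false_and, false_or, upperEnd, if_false]
    have hright : (osc m).IsRightmostEntry i ↔ ∀ j, oscIndex m j ≤ oscIndex m i :=
      forall_congr' fun j => (oscIndex_strictMono m).le_iff_le.symm
    rw [hright]
    refine ext (fun a b => b ≤ a) (fun a b h h' => le_antisymm h' h) m ?_ fun a ha => ?_
    · rw [mem_oscIndices]
      grind
    · rw [mem_oscIndices] at ha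
      grind

/-- Blocks outside `osc m` are empty, so that the subsequence may be read along an initial segment
of even length of the increasing oscillating sequence, where `lehmer_flatMap_oscBlock` applies. -/
theorem lehmer_osc_inflation (m : ℕ) (c : ℕ → List ℕ)
    (hc : ∀ i, i ∉ oscIndices m → c i = []) :
    lehmer ((List.finRange (osc m).length).flatMap fun i =>
      (c (oscIndex m i)).map fun y => toLex ((osc m).toPerm i, y)) = oscCode m c := by
  have hlist : (List.finRange (osc m).length).map (oscIndex m) =
      (List.range (2 * ((m + 1) / 2))).filter fun i => i ∈ oscIndices m := by
    refine List.Pairwise.eq_of_mem_iff (r := (· < ·)) ?_ ?_ fun n => ?_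
    · rw [List.pairwise_map]
      exact (List.pairwise_lt_finRange _).imp fun h => oscIndex_strictMono m h
    · exact List.pairwise_lt_range.filter _
    · simp only [List.mem_map, List.mem_finRange, true_and, List.mem_filter, List.mem_range,
        decide_eq_true_eq]
      constructor
      · rintro ⟨i, rfl⟩
        have := oscIndex_mem m i
        refine ⟨?_, this⟩
        rw [mem_oscIndices] at this
        grind
      · exact fun h => exists_oscIndex_eq h.2
  have hfilter : ∀ s : List ℕ,
      (s.filter fun i => i ∈ oscIndices m).flatMap (oscBlock c) = s.flatMap (oscBlock c) := by
    intro s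
    induction s with
    | nil => rfl
    | cons a s ih =>
      by_cases ha : a ∈ oscIndices m
      · simp [ha, ih]
      · simp [ha, ih, oscBlock, hc a ha]
  rw [lehmer_flatMap_congr (osc m).toPerm (fun i => oscSeq (oscIndex m i)) (osc_lt_iff m)
    (fun i j => by
      rw [(osc m).toPerm.injective.eq_iff, oscSeq_injective.eq_iff,
        (oscIndex_strictMono m).injective.eq_iff])
    (fun i => c (oscIndex m i))]
  change lehmer ((List.finRange (osc m).length).flatMap fun i => oscBlock c (oscIndex m i)) = _
  rw [← List.flatMap_map, hlist, hfilter, lehmer_flatMap_oscBlock, oscCode]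
  intro i hi
  refine hc i fun h => ?_
  rw [mem_oscIndices] at h
  grind

/-- The Lehmer codes of the closure of the antichain are the words which the automaton accepts. -/
theorem exists_lehmer_downClosure_iff (A : Set FinPerm) (α : FinPerm) (w : List ℕ) :
    (∃ σ ∈ downClosure (oscAntichain A α), lehmer σ.entries = w) ↔
      WordRun (OscStep {l | ∃ a ∈ A, l.Sublist a.entries} {l | l.Sublist α.entries})
        (· = .done) .start w := by
  have h1 : (∃ σ ∈ downClosure (oscAntichain A α), lehmer σ.entries = w) ↔
      ∃ π ∈ oscAntichain A α, ∃ l, l.Sublist π.entries ∧ lehmer l = w := by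
    simp only [← exists_contained_lehmer_iff]
    constructor
    · rintro ⟨σ, ⟨π, hπ, h⟩, hw⟩
      exact ⟨π, hπ, σ, h, hw⟩
    · rintro ⟨π, hπ, σ, h, hw⟩
      exact ⟨σ, ⟨π, hπ, h⟩, hw⟩
  rw [h1, wordRun_start_iff]
  constructor
  · rintro ⟨_, ⟨m, hm, β, hend, hinner, rfl⟩, h⟩
    obtain ⟨c, hc, rfl⟩ := (exists_sublist_entries_inflation _ _ _).mp h
    -- the blocks indexed by positions in the whole oscillating sequence, empty outside `osc m`
    let c' : ℕ → List ℕ := Function.extend (oscIndex m) c fun _ => []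
    have hc' : ∀ i, c' (oscIndex m i) = c i :=
      (oscIndex_strictMono m).injective.extend_apply _ _
    have hout : ∀ n, n ∉ oscIndices m → c' n = [] := fun n hn =>
      Function.extend_apply' _ _ _ fun ⟨i, hi⟩ => hn (hi ▸ oscIndex_mem m i)
    have hends : ∀ n ∈ oscIndices m, n = 1 ∨ n = upperEnd m → (c' n).Sublist α.entries := by
      intro n hn h
      obtain ⟨i, rfl⟩ := exists_oscIndex_eq hn
      rw [hc', ← hend i ((isOscEnd_iff hm i).mpr h)]
      exact hc i
    refine ⟨m, c', hm, ⟨?_, ?_, ?_, hout⟩, ?_⟩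
    · refine hends 1 ?_ (.inl rfl)
      rw [mem_oscIndices]
      grind
    · refine hends _ ?_ (.inr rfl)
      rw [mem_oscIndices, upperEnd]
      grind
    · intro n hn hn1 hnu
      obtain ⟨i, rfl⟩ := exists_oscIndex_eq hn
      rw [hc']
      refine ⟨β i, hinner i fun h => ?_, hc i⟩
      rcases (isOscEnd_iff hm i).mp h with h | h
      · exact hn1 h
      · exact hnu h
    · rw [← lehmer_osc_inflation m c' hout]
      simp only [hc']
  · rintro ⟨m, c, hm, hc, rfl⟩
    have hβ : ∀ i : Fin (osc m).length, ∃ b : FinPerm, (IsOscEnd m i → b = α) ∧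
        (¬ IsOscEnd m i → b ∈ A) ∧ (c (oscIndex m i)).Sublist b.entries := by
      intro i
      by_cases h : IsOscEnd m i
      · refine ⟨α, fun _ => rfl, fun h' => absurd h h', ?_⟩
        rcases (isOscEnd_iff hm i).mp h with h | h
        · rw [h]
          exact hc.lower
        · rw [h]
          exact hc.upper
      · have h' := h
        rw [isOscEnd_iff hm, not_or] at h'
        obtain ⟨a, ha, hca⟩ := hc.inner _ (oscIndex_mem m i) h'.1 h'.2
        exact ⟨a, fun h' => absurd h' h, fun _ => ha, hca⟩
    choose β hend hinner hsub using hβ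
    refine ⟨_, ⟨m, hm, β, hend, hinner, rfl⟩, ?_⟩
    exact (exists_sublist_entries_inflation _ _ _).mpr
      ⟨_, hsub, lehmer_osc_inflation m c hc.outer⟩

theorem finite_length_eq (n : ℕ) : {π : FinPerm | π.length = n}.Finite := by
  refine (Set.finite_range fun π : Equiv.Perm (Fin n) => (⟨n, π⟩ : FinPerm)).subset ?_
  rintro ⟨m, π⟩ rfl
  exact ⟨π, rfl⟩

theorem finite_avoidSet (τ : FinPerm) : (avoidSet τ).Finite :=
  (Set.finite_singleton τ).union ((finite_length_eq (τ.length + 1)).subset fun _ h => h.1)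

/-- For any finite set `A`, the closure of `U_{A,α}` has a rational generating function. -/
theorem isRationalSeries_genFun_downClosure_oscAntichain {A : Set FinPerm} (hA : A.Finite)
    (α : FinPerm) : IsRationalSeries (genFun (downClosure (oscAntichain A α))) := by
  have hsub : ∀ a : FinPerm, {l : List ℕ | l.Sublist a.entries}.Finite := fun a =>
    (List.finite_toSet a.entries.sublists).subset fun l hl => List.mem_sublists.mpr hl
  have hA' : {l : List ℕ | ∃ a ∈ A, l.Sublist a.entries}.Finite := by
    refine (hA.biUnion fun a _ => hsub a).subset ?_
    rintro l ⟨a, ha, hl⟩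
    exact Set.mem_biUnion ha hl
  apply isRationalSeries_genFun
  simp only [exists_lehmer_downClosure_iff]
  exact WordRun.isRationalSeries _ _ (finite_oscStep hA' (hsub α)) _

end FinPerm

theorem mainTheorem2 (k : ℕ) (α τ : FinPerm)
    (hα : α.length = k + 1) (hτ : τ.length + 1 = k) (hατ : ¬ τ.Contained α) :
    IsRationalSeries
      (FinPerm.genFun (FinPerm.downClosure (FinPerm.oscAntichain (FinPerm.avoidSet τ) α))) :=
  FinPerm.isRationalSeries_genFun_downClosure_oscAntichain (FinPerm.finite_avoidSet τ) α
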